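/- Let $T\in\{3,4,5\}$, $K\ge 0$, initial values $(y_{-1},y_0)\in\{0,1\}^2$ and $\gamma_1,\gamma_2\in\mathbb R$. For covariates $x=(x_1,\dots,x_T)\in(\mathbb R^K)^T$, $\beta\in\mathbb R^K$ and a fixed effect $\alpha\in\mathbb R$, the panel logit AR(2) model gives the outcome $y\in\{0,1\}^T$ the probability $$p(y,x,\beta,\gamma,\alpha)=\prod_{t=1}^T\frac1{1+\exp[(1-2y_t)(x_t'\beta+\gamma_1y_{t-1}+\gamma_2y_{t-2}+\alpha)]}.$$ A valid moment function (for given $y_{-1},y_0,x,\beta,\gamma$) is a function $m:\{0,1\}^T\to\mathbb R$ with $\sum_y p(y,x,\beta,\gamma,\alpha)\,m(y)=0$ for all $\alpha\in\mathbb R$. These functions form a linear space $\mathcal M(x,\beta,\gamma)$. For $\alpha_1<\dots<\alpha_{2^T}$ let $\bar P$ be the $2^T\times2^T$ matrix with entries $\bar P_{g,h}=p(y,x,\beta,\gamma,\alpha_g)$, $h=1+2^0y_1+\dots+2^{T-1}y_T$. (1) Without covariates: if $\beta=0$ and $\gamma_1,\gamma_2,\gamma_1+\gamma_2$ are nonzero,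 then $\operatorname{rk}(\bar P)=3T-2$ for every choice of $\alpha_1<\dots<\alpha_{2^T}$, and $\dim\mathcal M(x,0,\gamma)=2^T-(3T-2)$; that is, there are exactly $2^T-(3T-2)$ linearly independent moment functions. (2) With covariates: for all $x$, $\beta$, $\gamma$ we have $\dim\mathcal M(x,\beta,\gamma)\ge 2^T-4(T-1)$. If moreover $\gamma_1,\gamma_2,\gamma_1+\gamma_2,\gamma_1-\gamma_2$ are nonzero, then there are exactly $2^T-4(T-1)$ linearly independent moment functions for general covariates, in the following senses: (a) $\dim\mathcal M(x,\beta,\gamma)=2^T-4(T-1)$ for all $x,\beta$ such that $x_{t+1}'\beta-x_t'\beta\notin\{0,\pm\gamma_1,\pm\gamma_2,\pm(\gamma_1+\gamma_2)\}$ for $2\le t\le T-1$; (b) for every $\beta\ne0$, this equality holds for Lebesgue-almost every $x\in(\mathbb R^K)^T$; (c) for every $\beta\neq0$, $2^T-4(T-1)$ is the largest $N$ for which there are functions $m_1(\cdot,x),\dots,m_N(\cdot,x)$, $x\in(\mathbb R^K)^T$, that are, for every $x$, linearly independent elements of $\mathcal M(x,\beta,\gamma)$. -/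

import Mathlib

open MeasureTheory

/-- An outcome `(y_1, …, y_T) ∈ {0,1}^T`; the index `t : Fin T` stands for period `t + 1`. -/
abbrev Outcome (T : ℕ) : Type := Fin T → Fin 2

/-- The outcome one period before period `t`; it is the initial value `y_0` in the first period. -/
def lagOne {T : ℕ} (y0 : Fin 2) (y : Outcome T) (t : Fin T) : Fin 2 :=
  (Fin.cons y0 y : Fin (T + 1) → Fin 2) t.castSucc

/-- The outcome two periods before period `t`; it is the initial value `y_{-1}` in the first
period and the initial value `y_0` in the second one. -/
def lagTwo {T : ℕ} (ym1 y0 : Fin 2) (y : Outcome T) (t : Fin T) : Fin 2 :=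
  (Fin.cons ym1 (Fin.cons y0 y : Fin (T + 1) → Fin 2) : Fin (T + 2) → Fin 2)
    t.castSucc.castSucc

/-- The probability of the outcome `y` in the panel logit AR(2) model, given the initial values
`y_{-1}, y_0`, the covariates `x`, the common parameters `β, γ₁, γ₂` and the fixed effect `a`. -/
noncomputable def ar2Prob {T K : ℕ} (ym1 y0 : Fin 2) (x : Fin T → Fin K → ℝ) (β : Fin K → ℝ)
    (γ₁ γ₂ a : ℝ) (y : Outcome T) : ℝ :=
  ∏ t : Fin T, 1 / (1 + Real.exp ((1 - 2 * ((y t : ℕ) : ℝ)) *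
    (x t ⬝ᵥ β + ((lagOne y0 y t : ℕ) : ℝ) * γ₁ + ((lagTwo ym1 y0 y t : ℕ) : ℝ) * γ₂ + a)))

/-- The `2^T × 2^T` matrix of outcome probabilities: rows are the values `α g` of the fixed effect,
columns are the outcomes `y`, the (zero-based) column number of `y` being
`2^0 y_1 + 2^1 y_2 + ⋯ + 2^(T-1) y_T`. -/
noncomputable def ar2ProbMatrix {T K : ℕ} (ym1 y0 : Fin 2) (x : Fin T → Fin K → ℝ)
    (β : Fin K → ℝ) (γ₁ γ₂ : ℝ) (α : Fin (2 ^ T) → ℝ) : Matrix (Fin (2 ^ T)) (Fin (2 ^ T)) ℝ :=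
  Matrix.of fun g h => ar2Prob ym1 y0 x β γ₁ γ₂ (α g) (finFunctionFinEquiv.symm h)

/-- The valid moment functions: the functions `m` of the outcome whose conditional expectation,
given the initial values, the covariates and the fixed effect, is zero for every value of the
fixed effect. -/
noncomputable def ar2MomentSpace {T K : ℕ} (ym1 y0 : Fin 2) (x : Fin T → Fin K → ℝ)
    (β : Fin K → ℝ) (γ₁ γ₂ : ℝ) : Submodule ℝ (Outcome T → ℝ) where
  carrier := {m | ∀ a : ℝ, ∑ y : Outcome T, ar2Prob ym1 y0 x β γ₁ γ₂ a y * m y = 0}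
  zero_mem' := by
    intro a
    simp
  add_mem' := by
    intro m n hm hn a
    simp only [Pi.add_apply, mul_add, Finset.sum_add_distrib]
    rw [hm a, hn a, add_zero]
  smul_mem' := by
    intro c m hm a
    simp only [Pi.smul_apply, smul_eq_mul, mul_left_comm _ c, ← Finset.mul_sum]
    rw [hm a, mul_zero]

/-- The covariates are general (not special) for the given common parameters: from the second period
on, the change of the index `x_t' β` between two consecutive periods is none of
`0, ±γ₁, ±γ₂, ±(γ₁ + γ₂)`. -/
def GeneralCovariates {T K : ℕ} (x : Fin T → Fin K → ℝ) (β : Fin K → ℝ) (γ₁ γ₂ : ℝ) : Prop :=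
  ∀ s t : Fin T, 1 ≤ (s : ℕ) → (t : ℕ) = (s : ℕ) + 1 →
    x t ⬝ᵥ β - x s ⬝ᵥ β ∉ ({0, γ₁, -γ₁, γ₂, -γ₂, γ₁ + γ₂, -(γ₁ + γ₂)} : Set ℝ)

/-! In z = eᵃ a period contributes 1/(1 + cz) or cz/(1 + cz), the odds factor c depending on the
period and the two preceding outcomes. A moment function is a linear relation among the outcome
probabilities as functions of a, so by rank-nullity (`finrank_ar2MomentSpace_add`) only the
dimension of their span matters. A common denominator ∏ (1 + cz), c ∈ s, puts the span inside the
fractions with numerator of degree at most |s|, a space of dimension |s| + 1 (`finrank_fracSpace`).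

The span is this whole space if s grows period by period and every new factor d is reached by a path
that has used d before as often as s contains it. The probability of that path has a pole of maximal
order at z = -1/d; eliminating these poles leaves a fraction of the previous period
(`fracSpace_le_pathSpan_succ`, `pathSpan_eq_fracSpace`).

With covariates, s collects the factors of all attainable pairs of preceding outcomes, 1 + 2 + 4(T -
2) in number, so the span has dimension at most 4(T - 1). Equality holds if equal factors in
consecutive periods come only from pairs that can follow each other. Without covariates a
non-constant pair never occurs twice in a row, so two consecutive periods need its factor only once.
The alternating path attains this bound, and 1 + 2 + 3(T - 2) factors remain. -/

/-! ### Products of linear factors 1 + cX. -/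

open Polynomial in
/-- The polynomial `∏ (1 + c X)` over the elements `c` of a multiset. -/
noncomputable def denomPoly (s : Multiset ℝ) : ℝ[X] := (s.map fun c => 1 + C c * X).prod

lemma denomPoly_add (s t : Multiset ℝ) : denomPoly (s + t) = denomPoly s * denomPoly t := by
  simp [denomPoly]

open Polynomial in
lemma denomPoly_cons (c : ℝ) (s : Multiset ℝ) :
    denomPoly (c ::ₘ s) = (1 + C c * X) * denomPoly s := by
  simp [denomPoly]

open Polynomial in
lemma denomPoly_val (J : Finset ℝ) : denomPoly J.val = ∏ c ∈ J, (1 + C c * X) := rfl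

lemma eval_denomPoly (s : Multiset ℝ) (z : ℝ) :
    (denomPoly s).eval z = (s.map fun c => 1 + c * z).prod := by
  simp [denomPoly, Polynomial.eval_multiset_prod, Multiset.map_map]

lemma eval_denomPoly_exp_ne {s : Multiset ℝ} (hs : ∀ c ∈ s, 0 < c) (a : ℝ) :
    (denomPoly s).eval (Real.exp a) ≠ 0 := by
  rw [eval_denomPoly]
  refine Multiset.prod_ne_zero fun h => ?_
  obtain ⟨c, hc, h0⟩ := Multiset.mem_map.1 h
  have := hs c hc
  have : 0 < 1 + c * Real.exp a := by positivity
  exact this.ne' h0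

lemma eval_denomPoly_neg_inv_ne {s : Multiset ℝ} {c : ℝ} (hc : c ≠ 0) (hcs : c ∉ s) :
    (denomPoly s).eval (-c⁻¹) ≠ 0 := by
  rw [eval_denomPoly]
  refine Multiset.prod_ne_zero fun h => ?_
  obtain ⟨d, hd, h0⟩ := Multiset.mem_map.1 h
  have : c = d := by
    field_simp at h0
    linarith
  exact hcs (this ▸ hd)

open Polynomial in
lemma natDegree_one_add_C_mul_X {c : ℝ} (hc : c ≠ 0) : (1 + C c * X : ℝ[X]).natDegree = 1 := by
  have h : (1 + C c * X : ℝ[X]) = C c * X + C 1 := by simp [add_comm]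
  rw [h, natDegree_linear hc]

open Polynomial in
lemma one_add_C_mul_X_ne_zero (c : ℝ) : (1 + C c * X : ℝ[X]) ≠ 0 := fun h => by
  simpa using congrArg (Polynomial.eval 0) h

lemma denomPoly_ne_zero (s : Multiset ℝ) : denomPoly s ≠ 0 := fun h => by
  have := congrArg (Polynomial.eval 0) h
  simp [eval_denomPoly] at this

lemma natDegree_denomPoly_le (s : Multiset ℝ) : (denomPoly s).natDegree ≤ s.card := by
  induction s using Multiset.induction_on with
  | empty => simp [denomPoly]
  | cons c s ih =>
    rw [denomPoly_cons, Multiset.card_cons, add_comm s.card]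
    refine Polynomial.natDegree_mul_le_of_le ?_ ih
    compute_degree

lemma natDegree_denomPoly {s : Multiset ℝ} (hs : ∀ c ∈ s, 0 < c) :
    (denomPoly s).natDegree = s.card := by
  induction s using Multiset.induction_on with
  | empty => simp [denomPoly]
  | cons c s ih =>
    rw [denomPoly_cons, Multiset.card_cons,
      Polynomial.natDegree_mul (one_add_C_mul_X_ne_zero c) (denomPoly_ne_zero s),
      natDegree_one_add_C_mul_X (hs c (Multiset.mem_cons_self _ _)).ne',
      ih fun d hd => hs d (Multiset.mem_cons_of_mem hd), add_comm]

/-- A polynomial vanishing at all `-1/c`, `c ∈ J`, is divisible by `∏ (1 + c X)`. -/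
lemma denomPoly_dvd {J : Finset ℝ} (hJ : ∀ c ∈ J, 0 < c) {P : Polynomial ℝ}
    (hP : ∀ c ∈ J, P.eval (-c⁻¹) = 0) : denomPoly J.val ∣ P := by
  rw [denomPoly_val]
  refine Finset.prod_dvd_of_coprime ?_ ?_
  · intro c hc d hd hcd
    have hcd' : c - d ≠ 0 := sub_ne_zero.2 hcd
    -- Bézout: c(1 + dX) - d(1 + cX) = c - d.
    refine ⟨Polynomial.C (-d / (c - d)), Polynomial.C (c / (c - d)), ?_⟩
    refine Polynomial.funext fun z => ?_
    simp
    field_simp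
    ring
  · intro c hc
    have hc0 := (hJ c hc).ne'
    have h1 : (1 + Polynomial.C c * Polynomial.X : Polynomial ℝ)
        = Polynomial.C c * (Polynomial.X - Polynomial.C (-c⁻¹)) := by
      refine Polynomial.funext fun z => ?_
      simp
      field_simp
      ring
    rw [h1, IsUnit.mul_left_dvd (Polynomial.isUnit_C.2 hc0.isUnit), Polynomial.dvd_iff_isRoot]
    exact hP c hc

/-! ### Fractions over a fixed denominator. -/

/-- The linear map sending `P` to the function `a ↦ P(eᵃ) / ∏ (1 + c eᵃ)`. -/
noncomputable def fracMap (s : Multiset ℝ) : Polynomial ℝ →ₗ[ℝ] (ℝ → ℝ) where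
  toFun P a := P.eval (Real.exp a) / (denomPoly s).eval (Real.exp a)
  map_add' P Q := by
    ext a
    simp [add_div]
  map_smul' r P := by
    ext a
    simp [mul_div_assoc]

lemma fracMap_apply (s : Multiset ℝ) (P : Polynomial ℝ) (a : ℝ) :
    fracMap s P a = P.eval (Real.exp a) / (denomPoly s).eval (Real.exp a) := rfl

lemma fracMap_mul {s t : Multiset ℝ} (ht : ∀ c ∈ t, 0 < c) (P : Polynomial ℝ) :
    fracMap (s + t) (P * denomPoly t) = fracMap s P := by
  ext a
  have := eval_denomPoly_exp_ne ht a
  rw [fracMap_apply, fracMap_apply, denomPoly_add, Polynomial.eval_mul, Polynomial.eval_mul,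
    mul_div_mul_right _ _ this]

/-- The functions `a ↦ P(eᵃ) / ∏ (1 + c eᵃ)` with `deg P` at most the number of factors. -/
noncomputable def fracSpace (s : Multiset ℝ) : Submodule ℝ (ℝ → ℝ) :=
  (Polynomial.degreeLT ℝ (s.card + 1)).map (fracMap s)

lemma mem_degreeLT_succ {P : Polynomial ℝ} {n : ℕ} :
    P ∈ Polynomial.degreeLT ℝ (n + 1) ↔ P.natDegree ≤ n := by
  rw [Polynomial.mem_degreeLT, Polynomial.natDegree_le_iff_coeff_eq_zero,
    Polynomial.degree_lt_iff_coeff_zero]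
  exact Iff.rfl

/-- An element of `fracSpace s` vanishing at `card s + 1` points is zero. -/
lemma eq_zero_of_mem_fracSpace {s : Multiset ℝ} (hs : ∀ c ∈ s, 0 < c) {P : Polynomial ℝ}
    (hP : P ∈ Polynomial.degreeLT ℝ (s.card + 1)) {ι : Type*} [Fintype ι] {α : ι → ℝ}
    (hα : Function.Injective α) (hι : s.card < Fintype.card ι)
    (h : ∀ i, fracMap s P (α i) = 0) : P = 0 := by
  refine Polynomial.eq_zero_of_natDegree_lt_card_of_eval_eq_zero P
    (f := fun i => Real.exp (α i)) (Real.exp_injective.comp hα) (fun i => ?_)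
    ((mem_degreeLT_succ.1 hP).trans_lt hι)
  exact (div_eq_zero_iff.1 (h i)).resolve_right (eval_denomPoly_exp_ne hs _)

lemma finrank_fracSpace {s : Multiset ℝ} (hs : ∀ c ∈ s, 0 < c) :
    Module.finrank ℝ (fracSpace s) = s.card + 1 := by
  have hinj : Function.Injective
      ((fracMap s).domRestrict (Polynomial.degreeLT ℝ (s.card + 1))) := by
    rw [← LinearMap.ker_eq_bot, LinearMap.ker_eq_bot']
    rintro ⟨P, hP⟩ h
    refine Subtype.ext (eq_zero_of_mem_fracSpace hs hP
      (α := fun i : Fin (s.card + 1) => ((i : ℕ) : ℝ)) ?_ (by simp) fun i => congrFun h _)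
    intro i j hij
    exact Fin.ext (Nat.cast_injective hij)
  have hr : fracSpace s = LinearMap.range
      ((fracMap s).domRestrict (Polynomial.degreeLT ℝ (s.card + 1))) := by
    rw [LinearMap.range_domRestrict]
    rfl
  rw [hr, LinearMap.finrank_range_of_inj hinj,
    (Polynomial.degreeLTEquiv ℝ (s.card + 1)).finrank_eq, Module.finrank_fin_fun]

/-! ### Path probabilities as fractions. -/

/-- The odds factor in period `t` along the sequence `y`, whose terms `y 0`, `y 1` are the initial
values. -/
def pathFactor (c : ℕ → Fin 2 → Fin 2 → ℝ) (y : ℕ → Fin 2) (t : ℕ) : ℝ := c t (y (t + 1)) (y t)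

/-- The probability of the outcomes in the first `n` periods as a function of the fixed effect. -/
noncomputable def pathProb (c : ℕ → Fin 2 → Fin 2 → ℝ) (n : ℕ) (y : ℕ → Fin 2) (a : ℝ) : ℝ :=
  ∏ t ∈ Finset.range n, (if y (t + 2) = 1 then pathFactor c y t * Real.exp a else 1) /
    (1 + pathFactor c y t * Real.exp a)

/-- The odds factors of the first `n` periods. -/
def pathFactors (c : ℕ → Fin 2 → Fin 2 → ℝ) (n : ℕ) (y : ℕ → Fin 2) : Multiset ℝ :=
  (Multiset.range n).map (pathFactor c y)

/-- The span of the outcome probabilities of the first `n` periods. -/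
noncomputable def pathSpan (c : ℕ → Fin 2 → Fin 2 → ℝ) (i₀ i₁ : Fin 2) (n : ℕ) :
    Submodule ℝ (ℝ → ℝ) :=
  Submodule.span ℝ (pathProb c n '' {y | y 0 = i₀ ∧ y 1 = i₁})

open Polynomial in
/-- The numerator of the probability of a sequence over the common denominator given by `s`. -/
noncomputable def pathNum (c : ℕ → Fin 2 → Fin 2 → ℝ) (n : ℕ) (y : ℕ → Fin 2) (s : Multiset ℝ) :
    ℝ[X] :=
  (∏ t ∈ Finset.range n, if y (t + 2) = 1 then C (pathFactor c y t) * X else 1) *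
    denomPoly (s - pathFactors c n y)

lemma pathFactors_eq_sum (c : ℕ → Fin 2 → Fin 2 → ℝ) (n : ℕ) (y : ℕ → Fin 2) :
    pathFactors c n y = ∑ r ∈ Finset.range n, {pathFactor c y r} := by
  induction n with
  | zero => rfl
  | succ n ih =>
    rw [Finset.sum_range_succ, ← ih, pathFactors, Multiset.range_succ, Multiset.map_cons,
      ← Multiset.singleton_add, add_comm, pathFactors]

lemma pathProb_eq_fracMap {c : ℕ → Fin 2 → Fin 2 → ℝ} {n : ℕ} {y : ℕ → Fin 2} {s : Multiset ℝ}
    (hs : pathFactors c n y ≤ s) (hpos : ∀ d ∈ s, 0 < d) :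
    pathProb c n y = fracMap s (pathNum c n y s) := by
  ext a
  obtain ⟨u, rfl⟩ := Multiset.le_iff_exists_add.1 hs
  have hu : (denomPoly u).eval (Real.exp a) ≠ 0 :=
    eval_denomPoly_exp_ne (fun d hd => hpos d (Multiset.mem_add.2 (Or.inr hd))) a
  rw [fracMap_apply, pathNum, add_tsub_cancel_left, denomPoly_add, Polynomial.eval_mul,
    Polynomial.eval_mul, mul_div_mul_right _ _ hu, pathProb, Finset.prod_div_distrib,
    Polynomial.eval_prod, eval_denomPoly, pathFactors, Multiset.map_map]
  congr 1
  refine Finset.prod_congr rfl fun t _ => ?_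
  split_ifs <;> simp

lemma natDegree_pathNum_le {c : ℕ → Fin 2 → Fin 2 → ℝ} {n : ℕ} {y : ℕ → Fin 2} {s : Multiset ℝ}
    (hs : pathFactors c n y ≤ s) : (pathNum c n y s).natDegree ≤ s.card := by
  have h1 : (∏ t ∈ Finset.range n, if y (t + 2) = 1 then
      Polynomial.C (pathFactor c y t) * Polynomial.X else 1).natDegree ≤ n := by
    refine (Polynomial.natDegree_prod_le _ _).trans ?_
    refine (Finset.sum_le_card_nsmul _ _ 1 fun t _ => ?_).trans (by simp)
    split_ifs
    · compute_degree
    · simp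
  have h2 := natDegree_denomPoly_le (s - pathFactors c n y)
  rw [Multiset.card_sub hs] at h2
  have h3 := Multiset.card_le_card hs
  have h4 : (pathFactors c n y).card = n := by simp [pathFactors]
  have := Polynomial.natDegree_mul_le_of_le h1 h2
  rw [pathNum]
  omega

/-- Apart from the cofactor, the numerator is a monomial with nonzero coefficient, so it can vanish
at -1/d only if d is one of the factors the path misses. -/
lemma eval_pathNum_ne {c : ℕ → Fin 2 → Fin 2 → ℝ} (hc : ∀ t i j, 0 < c t i j)
    {n : ℕ} {y : ℕ → Fin 2} {s : Multiset ℝ} {d : ℝ} (hd : 0 < d)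
    (hds : d ∉ s - pathFactors c n y) : (pathNum c n y s).eval (-d⁻¹) ≠ 0 := by
  rw [pathNum, Polynomial.eval_mul, Polynomial.eval_prod]
  refine mul_ne_zero (Finset.prod_ne_zero_iff.2 fun t _ => ?_)
    (eval_denomPoly_neg_inv_ne hd.ne' hds)
  have : pathFactor c y t ≠ 0 := (hc _ _ _).ne'
  split_ifs
  · simp [this, hd.ne']
  · simp

lemma pathProb_mem_fracSpace {c : ℕ → Fin 2 → Fin 2 → ℝ} {n : ℕ} {y : ℕ → Fin 2} {s : Multiset ℝ}
    (hs : pathFactors c n y ≤ s) (hpos : ∀ d ∈ s, 0 < d) : pathProb c n y ∈ fracSpace s :=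
  ⟨pathNum c n y s, mem_degreeLT_succ.2 (natDegree_pathNum_le hs),
    (pathProb_eq_fracMap hs hpos).symm⟩

lemma pathSpan_le_fracSpace {c : ℕ → Fin 2 → Fin 2 → ℝ} {i₀ i₁ : Fin 2} {n : ℕ} {s : Multiset ℝ}
    (hs : ∀ y : ℕ → Fin 2, y 0 = i₀ → y 1 = i₁ → pathFactors c n y ≤ s)
    (hpos : ∀ d ∈ s, 0 < d) : pathSpan c i₀ i₁ n ≤ fracSpace s := by
  refine Submodule.span_le.2 ?_
  rintro _ ⟨y, ⟨h0, h1⟩, rfl⟩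
  exact pathProb_mem_fracSpace (hs y h0 h1) hpos

lemma pathProb_update_succ {c : ℕ → Fin 2 → Fin 2 → ℝ} (n : ℕ) (y : ℕ → Fin 2) (b : Fin 2) (a : ℝ) :
    pathProb c (n + 1) (Function.update y (n + 2) b) a = pathProb c n y a *
      ((if b = 1 then pathFactor c y n * Real.exp a else 1) /
        (1 + pathFactor c y n * Real.exp a)) := by
  have hf : ∀ t ≤ n, pathFactor c (Function.update y (n + 2) b) t = pathFactor c y t := by
    intro t ht
    simp only [pathFactor]
    rw [Function.update_of_ne (by omega), Function.update_of_ne (by omega)]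
  rw [pathProb, Finset.prod_range_succ, Function.update_self, hf n le_rfl, pathProb]
  congr 1
  refine Finset.prod_congr rfl fun t ht => ?_
  have ht' := Finset.mem_range.1 ht
  rw [hf t ht'.le, Function.update_of_ne (by omega)]

lemma pathProb_update_mem {c : ℕ → Fin 2 → Fin 2 → ℝ} {i₀ i₁ : Fin 2} {n : ℕ} {y : ℕ → Fin 2}
    (h0 : y 0 = i₀) (h1 : y 1 = i₁) (b : Fin 2) : pathProb c (n + 1) (Function.update y (n + 2) b) ∈ pathSpan c i₀ i₁ (n + 1) := by
  refine Submodule.subset_span ⟨_, ⟨?_, ?_⟩, rfl⟩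
  · rwa [Function.update_of_ne (by omega)]
  · rwa [Function.update_of_ne (by omega)]

/-- Summing over the next outcome recovers the probability of the shorter path. -/
lemma pathSpan_le_succ {c : ℕ → Fin 2 → Fin 2 → ℝ} (hc : ∀ t i j, 0 < c t i j)
    (i₀ i₁ : Fin 2) (n : ℕ) :
    pathSpan c i₀ i₁ n ≤ pathSpan c i₀ i₁ (n + 1) := by
  refine Submodule.span_le.2 ?_
  rintro _ ⟨y, ⟨h0, h1⟩, rfl⟩
  have h : pathProb c n y = pathProb c (n + 1) (Function.update y (n + 2) 0) +
      pathProb c (n + 1) (Function.update y (n + 2) 1) := by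
    ext a
    have hp : 0 < pathFactor c y n := hc _ _ _
    have : 1 + pathFactor c y n * Real.exp a ≠ 0 := by positivity
    rw [Pi.add_apply, pathProb_update_succ, pathProb_update_succ]
    simp only [zero_ne_one, if_false, if_true]
    field_simp
  rw [h]
  exact Submodule.add_mem _ (pathProb_update_mem h0 h1 0) (pathProb_update_mem h0 h1 1)

/-! ### Induction on the number of periods. -/

/-- One more period adds the new factors `J`, if each of them is attained by a sequence along which
it has already occurred as often as possible. -/
lemma fracSpace_le_pathSpan_succ {c : ℕ → Fin 2 → Fin 2 → ℝ} (hc : ∀ t i j, 0 < c t i j)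
    {i₀ i₁ : Fin 2} {n : ℕ} {s : Multiset ℝ} {J : Finset ℝ}
    (hpos : ∀ d ∈ s, 0 < d) (hJ : ∀ d ∈ J, 0 < d) (h : fracSpace s ≤ pathSpan c i₀ i₁ n)
    (hy : ∀ d ∈ J, ∃ y : ℕ → Fin 2, y 0 = i₀ ∧ y 1 = i₁ ∧ pathFactor c y n = d ∧
      pathFactors c n y ≤ s ∧ d ∉ s - pathFactors c n y) :
    fracSpace (s + J.val) ≤ pathSpan c i₀ i₁ (n + 1) := by
  choose! y h0 h1 hyn hys hyd using hy
  rintro _ ⟨P, hP, rfl⟩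
  rw [SetLike.mem_coe, mem_degreeLT_succ, Multiset.card_add] at hP
  -- The numerator, over the denominator of s + J, of the path for d prolonged by the outcome 0,
  -- whose last period contributes 1/(1 + dz). Among the points -1/e, e ∈ J, it is nonzero exactly
  -- at e = d.
  set N : ℝ → Polynomial ℝ := fun d => pathNum c n (y d) s * denomPoly (J.erase d).val with hN
  have hNdeg : ∀ d ∈ J, (N d).natDegree ≤ s.card + J.val.card := by
    intro d hd
    refine Polynomial.natDegree_mul_le_of_le (natDegree_pathNum_le (hys d hd)) ?_
    exact (natDegree_denomPoly_le _).trans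
      (Multiset.card_le_card (Finset.val_le_iff.2 (Finset.erase_subset _ _)))
  have hNself : ∀ d ∈ J, (N d).eval (-d⁻¹) ≠ 0 := by
    intro d hd
    rw [hN, Polynomial.eval_mul]
    exact mul_ne_zero (eval_pathNum_ne hc (hJ d hd) (hyd d hd))
      (eval_denomPoly_neg_inv_ne (hJ d hd).ne' (Finset.notMem_erase d J))
  have hNne : ∀ d ∈ J, ∀ e ∈ J, d ≠ e → (N d).eval (-e⁻¹) = 0 := by
    intro d hd e he hde
    rw [hN, Polynomial.eval_mul, denomPoly_val, Polynomial.eval_prod,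
      Finset.prod_eq_zero (Finset.mem_erase.2 ⟨hde.symm, he⟩), mul_zero]
    simp [(hJ e he).ne']
  have hNmem : ∀ d ∈ J, fracMap (s + J.val) (N d) ∈ pathSpan c i₀ i₁ (n + 1) := by
    intro d hd
    convert pathProb_update_mem (c := c) (n := n) (h0 d hd) (h1 d hd) 0 using 1
    ext a
    have hJe : J.val = (J.erase d).val + {d} := by
      conv_lhs => rw [← Finset.insert_erase hd,
        Finset.insert_val_of_notMem (Finset.notMem_erase _ _)]
      rw [add_comm, Multiset.singleton_add]
    have hposd : ∀ e ∈ (J.erase d).val, 0 < e := fun e he => hJ e (Finset.mem_of_mem_erase he)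
    rw [pathProb_update_succ, hyn d hd, pathProb_eq_fracMap (hys d hd) hpos, hJe, hN]
    have e1 : s + ((J.erase d).val + {d}) = s + {d} + (J.erase d).val := by
      rw [add_assoc, add_comm ((J.erase d).val)]
    rw [e1, fracMap_mul hposd, fracMap_apply, fracMap_apply, denomPoly_add, Polynomial.eval_mul]
    simp [eval_denomPoly, div_eq_mul_inv]
    ring
  -- Interpolation at the points -1/d: the remainder R is divisible by the new factors, and
  -- cancelling them gives a fraction over s.
  set R : Polynomial ℝ := P - ∑ d ∈ J, (P.eval (-d⁻¹) / (N d).eval (-d⁻¹)) • N d with hR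
  have hRroot : ∀ e ∈ J, R.eval (-e⁻¹) = 0 := by
    intro e he
    rw [hR, Polynomial.eval_sub, Polynomial.eval_finsetSum, Finset.sum_eq_single e]
    · rw [Polynomial.eval_smul, smul_eq_mul, div_mul_cancel₀ _ (hNself e he), sub_self]
    · intro d hd hde
      rw [Polynomial.eval_smul, hNne d hd e he hde, smul_zero]
    · exact fun h => absurd he h
  obtain ⟨S, hS⟩ := denomPoly_dvd hJ hRroot
  have hRdeg : R.natDegree ≤ s.card + J.val.card := by
    refine (Polynomial.natDegree_sub_le_of_le hP
      (Polynomial.natDegree_sum_le_of_forall_le _ _ ?_)).trans (max_self _).le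
    exact fun d hd => (Polynomial.natDegree_smul_le _ _).trans (hNdeg d hd)
  have hSdeg : S.natDegree ≤ s.card := by
    rcases eq_or_ne S 0 with rfl | hS0
    · simp
    · rw [hS, Polynomial.natDegree_mul (denomPoly_ne_zero _) hS0, natDegree_denomPoly hJ] at hRdeg
      omega
  have hRmem : fracMap (s + J.val) R ∈ pathSpan c i₀ i₁ (n + 1) := by
    rw [hS, mul_comm, fracMap_mul hJ]
    exact pathSpan_le_succ hc i₀ i₁ n (h ⟨S, mem_degreeLT_succ.2 hSdeg, rfl⟩)
  have hPR : P = R + ∑ d ∈ J, (P.eval (-d⁻¹) / (N d).eval (-d⁻¹)) • N d := by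
    rw [hR, sub_add_cancel]
  rw [hPR, map_add, map_sum]
  refine Submodule.add_mem _ hRmem (Submodule.sum_mem _ fun d hd => ?_)
  rw [map_smul]
  exact Submodule.smul_mem _ _ (hNmem d hd)

/-- The span of the outcome probabilities consists of all fractions over the common denominator if
the factors new in each period are attained by suitable sequences. -/
lemma pathSpan_eq_fracSpace {c : ℕ → Fin 2 → Fin 2 → ℝ} (hc : ∀ t i j, 0 < c t i j)
    {i₀ i₁ : Fin 2} {J : ℕ → Finset ℝ} (n : ℕ)
    (hle : ∀ t ≤ n, ∀ y : ℕ → Fin 2, y 0 = i₀ → y 1 = i₁ →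
      pathFactors c t y ≤ ∑ r ∈ Finset.range t, (J r).val)
    (hJ : ∀ t < n, ∀ d ∈ J t, ∃ y : ℕ → Fin 2, y 0 = i₀ ∧ y 1 = i₁ ∧ pathFactor c y t = d ∧
      ∀ r < t, d ∈ J r → pathFactor c y r = d) :
    pathSpan c i₀ i₁ n = fracSpace (∑ r ∈ Finset.range n, (J r).val) := by
  have hJpos : ∀ t < n, ∀ d ∈ J t, 0 < d := by
    intro t ht d hd
    obtain ⟨y, -, -, rfl, -⟩ := hJ t ht d hd
    exact hc _ _ _
  have hspos : ∀ t ≤ n, ∀ d ∈ ∑ r ∈ Finset.range t, (J r).val, 0 < d := by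
    intro t ht d hd
    obtain ⟨r, hr, hdr⟩ := Multiset.mem_sum.1 hd
    exact hJpos r ((Finset.mem_range.1 hr).trans_le ht) d hdr
  refine le_antisymm (pathSpan_le_fracSpace (hle n le_rfl) (hspos n le_rfl)) ?_
  suffices H : ∀ t ≤ n, fracSpace (∑ r ∈ Finset.range t, (J r).val) ≤ pathSpan c i₀ i₁ t from
    H n le_rfl
  intro t
  induction t with
  | zero =>
    rintro - _ ⟨P, hP, rfl⟩
    rw [SetLike.mem_coe, mem_degreeLT_succ] at hP
    obtain ⟨r, rfl⟩ := Polynomial.natDegree_eq_zero.1 (Nat.le_zero.1 (hP.trans (by simp)))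
    have h1 : pathProb c 0 (fun k => if k = 0 then i₀ else i₁) ∈ pathSpan c i₀ i₁ 0 :=
      Submodule.subset_span ⟨_, ⟨by simp, by simp⟩, rfl⟩
    convert Submodule.smul_mem _ r h1 using 1
    ext a
    simp [fracMap_apply, pathProb, denomPoly]
  | succ t ih =>
    intro ht
    rw [Finset.sum_range_succ]
    refine fracSpace_le_pathSpan_succ hc (hspos t (by omega)) (hJpos t ht) (ih (by omega)) ?_
    intro d hd
    obtain ⟨y, h0, h1, hyt, hyr⟩ := hJ t ht d hd
    refine ⟨y, h0, h1, hyt, hle t (by omega) y h0 h1, ?_⟩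
    -- The multiplicities of d are compared period by period: J r contains d at most once, and then
    -- the path has factor d in period r.
    rw [← Multiset.count_eq_zero, Multiset.count_sub, Nat.sub_eq_zero_iff_le,
      Multiset.count_sum', pathFactors_eq_sum, Multiset.count_sum']
    refine Finset.sum_le_sum fun r hr => ?_
    by_cases hdr : d ∈ J r
    · rw [hyr r (Finset.mem_range.1 hr) hdr, Multiset.count_singleton_self]
      exact Multiset.nodup_iff_count_le_one.1 (J r).nodup d
    · rw [Multiset.count_eq_zero_of_notMem hdr]
      exact Nat.zero_le _

/-! ### Time-dependent factors: all attainable pairs. -/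

/-- The pairs (last outcome, outcome before) that can precede period `t`. -/
def attainable (i₀ i₁ : Fin 2) (t : ℕ) : Finset (Fin 2 × Fin 2) :=
  Finset.univ.filter fun σ => (t = 0 → σ = (i₁, i₀)) ∧ (t = 1 → σ.2 = i₁)

lemma mem_attainable {i₀ i₁ : Fin 2} {t : ℕ} {σ : Fin 2 × Fin 2} :
    σ ∈ attainable i₀ i₁ t ↔ (t = 0 → σ = (i₁, i₀)) ∧ (t = 1 → σ.2 = i₁) := by
  simp [attainable]

lemma card_attainable_zero (i₀ i₁ : Fin 2) : (attainable i₀ i₁ 0).card = 1 := by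
  revert i₀ i₁; decide

lemma card_attainable_one (i₀ i₁ : Fin 2) : (attainable i₀ i₁ 1).card = 2 := by
  revert i₀ i₁; decide

lemma card_attainable_add_two (i₀ i₁ : Fin 2) (t : ℕ) : (attainable i₀ i₁ (t + 2)).card = 4 := by
  simp [attainable]

lemma sum_card_attainable (i₀ i₁ : Fin 2) (n : ℕ) :
    ∑ r ∈ Finset.range (n + 2), (attainable i₀ i₁ r).card = 4 * n + 3 := by
  induction n with
  | zero => simp [Finset.sum_range_succ, card_attainable_zero, card_attainable_one]
  | succ n ih =>
    rw [Finset.sum_range_succ, ih, card_attainable_add_two]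
    ring

lemma pair_mem_attainable {i₀ i₁ : Fin 2} {y : ℕ → Fin 2} (h0 : y 0 = i₀) (h1 : y 1 = i₁) (t : ℕ) :
    (y (t + 1), y t) ∈ attainable i₀ i₁ t := by
  refine mem_attainable.2 ⟨?_, ?_⟩
  · rintro rfl
    rw [h0, h1]
  · rintro rfl
    exact h1

/-- The values of the odds factor in period `t`. -/
def attainableFactors (c : ℕ → Fin 2 → Fin 2 → ℝ) (i₀ i₁ : Fin 2) (t : ℕ) : Multiset ℝ :=
  (attainable i₀ i₁ t).val.map fun σ => c t σ.1 σ.2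

lemma pathFactors_le_attainableFactors {c : ℕ → Fin 2 → Fin 2 → ℝ} {i₀ i₁ : Fin 2} {y : ℕ → Fin 2}
    (h0 : y 0 = i₀) (h1 : y 1 = i₁) (n : ℕ) :
    pathFactors c n y ≤ ∑ r ∈ Finset.range n, attainableFactors c i₀ i₁ r := by
  rw [pathFactors_eq_sum]
  refine Finset.sum_le_sum fun r _ => Multiset.singleton_le.2 ?_
  exact Multiset.mem_map.2 ⟨(y (r + 1), y r), pair_mem_attainable h0 h1 r, rfl⟩

lemma card_sum_attainableFactors (c : ℕ → Fin 2 → Fin 2 → ℝ) (i₀ i₁ : Fin 2) (n : ℕ) :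
    (∑ r ∈ Finset.range (n + 2), attainableFactors c i₀ i₁ r).card = 4 * n + 3 := by
  rw [Multiset.card_sum, ← sum_card_attainable i₀ i₁ n]
  exact Finset.sum_congr rfl fun r _ => by rw [attainableFactors, Multiset.card_map]; rfl

lemma pos_of_mem_sum_attainableFactors {c : ℕ → Fin 2 → Fin 2 → ℝ} (hc : ∀ t i j, 0 < c t i j)
    {i₀ i₁ : Fin 2} {n : ℕ} : ∀ d ∈ ∑ r ∈ Finset.range n, attainableFactors c i₀ i₁ r, 0 < d := by
  intro d hd
  obtain ⟨r, -, hr⟩ := Multiset.mem_sum.1 hd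
  obtain ⟨σ, -, rfl⟩ := Multiset.mem_map.1 hr
  exact hc _ _ _

lemma pathSpan_le_fracSpace_attainable {c : ℕ → Fin 2 → Fin 2 → ℝ} (hc : ∀ t i j, 0 < c t i j)
    (i₀ i₁ : Fin 2) (n : ℕ) : pathSpan c i₀ i₁ n ≤
      fracSpace (∑ r ∈ Finset.range n, attainableFactors c i₀ i₁ r) :=
  pathSpan_le_fracSpace (fun _ h0 h1 => pathFactors_le_attainableFactors h0 h1 n)
    (pos_of_mem_sum_attainableFactors hc)

/-- If factors of different pairs differ within a period, and coincide between consecutive periods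
only for compatible pairs, then the outcome probabilities span all fractions. -/
lemma pathSpan_eq_fracSpace_attainable {c : ℕ → Fin 2 → Fin 2 → ℝ} (hc : ∀ t i j, 0 < c t i j)
    (i₀ i₁ : Fin 2) (n : ℕ)
    (hinj : ∀ t < n, Function.Injective fun σ : Fin 2 × Fin 2 => c t σ.1 σ.2)
    (hcompat : ∀ t, 1 ≤ t → t + 1 < n → ∀ σ τ : Fin 2 × Fin 2,
      c t σ.1 σ.2 = c (t + 1) τ.1 τ.2 → τ.2 = σ.1) :
    pathSpan c i₀ i₁ n = fracSpace (∑ r ∈ Finset.range n, attainableFactors c i₀ i₁ r) := by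
  classical
  set J : ℕ → Finset ℝ := fun t => (attainable i₀ i₁ t).image fun σ => c t σ.1 σ.2 with hJ
  have hJval : ∀ t < n, (J t).val = attainableFactors c i₀ i₁ t := fun t ht =>
    Finset.image_val_of_injOn (hinj t ht).injOn
  have hsum : ∀ t ≤ n, ∑ r ∈ Finset.range t, attainableFactors c i₀ i₁ r =
      ∑ r ∈ Finset.range t, (J r).val := fun t ht =>
    Finset.sum_congr rfl fun r hr => (hJval r ((Finset.mem_range.1 hr).trans_le ht)).symm
  rw [hsum n le_rfl]
  refine pathSpan_eq_fracSpace hc n (fun t ht y h0 h1 => ?_) fun t ht d hd => ?_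
  · rw [← hsum t ht]
    exact pathFactors_le_attainableFactors h0 h1 t
  have hex : ∀ r, d ∈ J r → ∃ σ ∈ attainable i₀ i₁ r, c r σ.1 σ.2 = d := fun r hr =>
    Finset.mem_image.1 hr
  choose! s hs hsd using hex
  -- Only consecutive periods constrain each other, since pairs two periods apart share no outcome.
  -- In periods 0 and 1 the initial values force compatibility.
  have hkey : ∀ r < n, d ∈ J r → d ∈ J (r + 1) → r + 1 < n → (s (r + 1)).2 = (s r).1 := by
    intro r hr hdr hdr' hr'
    rcases Nat.eq_zero_or_pos r with rfl | hpos
    · rw [(mem_attainable.1 (hs 0 hdr)).1 rfl, (mem_attainable.1 (hs _ hdr')).2 rfl]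
    · exact hcompat r hpos hr' _ _ (by rw [hsd r hdr, hsd _ hdr'])
  -- The outcome y k is an entry of the pairs of periods k and k - 1 only. It is read off period k
  -- if d occurs there, and otherwise off period k - 1, where the value is arbitrary if d does not
  -- occur.
  let y : ℕ → Fin 2 := fun k => if k = 0 then i₀ else if k = 1 then i₁ else
    if d ∈ J k ∧ k < n then (s k).2 else (s (k - 1)).1
  have hy : ∀ r < n, d ∈ J r → y (r + 1) = (s r).1 ∧ y r = (s r).2 := by
    intro r hr hdr
    constructor
    · rcases Nat.eq_zero_or_pos r with rfl | hpos
      · simp [y, (mem_attainable.1 (hs 0 hdr)).1 rfl]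
      · simp only [y, Nat.add_eq_zero_iff, one_ne_zero, and_false, if_false, Nat.add_eq_right,
          hpos.ne', Nat.add_sub_cancel]
        split_ifs with h
        · exact hkey r hr hdr h.1 h.2
        · rfl
    · simp only [y]
      split_ifs with h0 h1 h2
      · subst h0
        rw [(mem_attainable.1 (hs 0 hdr)).1 rfl]
      · subst h1
        rw [(mem_attainable.1 (hs 1 hdr)).2 rfl]
      · rfl
      · exact absurd ⟨hdr, hr⟩ h2
  have hfac : ∀ r < n, d ∈ J r → pathFactor c y r = d := by
    intro r hr hdr
    rw [pathFactor, (hy r hr hdr).1, (hy r hr hdr).2, hsd r hdr]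
  exact ⟨y, rfl, rfl, hfac t ht hd, fun r hr hdr => hfac r (hr.trans ht) hdr⟩

/-! ### Time-independent factors: constant and alternating pairs. -/

/-- The sequence that alternates after the initial values. -/
def altSeq (i₀ i₁ : Fin 2) : ℕ → Fin 2
  | 0 => i₀
  | 1 => i₁
  | n + 2 => 1 - altSeq i₀ i₁ (n + 1)

/-- The attainable pairs that are constant or belong to the alternating sequence. -/
def newPairs (i₀ i₁ : Fin 2) (t : ℕ) : Finset (Fin 2 × Fin 2) :=
  (attainable i₀ i₁ t).filter fun σ =>
    σ.1 = σ.2 ∨ σ = (altSeq i₀ i₁ (t + 1), altSeq i₀ i₁ t)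

lemma mem_newPairs {i₀ i₁ : Fin 2} {t : ℕ} {σ : Fin 2 × Fin 2} : σ ∈ newPairs i₀ i₁ t ↔
    σ ∈ attainable i₀ i₁ t ∧ (σ.1 = σ.2 ∨ σ = (altSeq i₀ i₁ (t + 1), altSeq i₀ i₁ t)) := by
  simp [newPairs]

lemma altSeq_mem_newPairs (i₀ i₁ : Fin 2) (t : ℕ) :
    (altSeq i₀ i₁ (t + 1), altSeq i₀ i₁ t) ∈ newPairs i₀ i₁ t :=
  mem_newPairs.2 ⟨pair_mem_attainable rfl rfl t, Or.inr rfl⟩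

lemma card_newPairs_zero (i₀ i₁ : Fin 2) : (newPairs i₀ i₁ 0).card = 1 := by
  revert i₀ i₁; decide

lemma card_newPairs_one (i₀ i₁ : Fin 2) : (newPairs i₀ i₁ 1).card = 2 := by
  revert i₀ i₁; decide

lemma card_newPairs_add_two (i₀ i₁ : Fin 2) (t : ℕ) : (newPairs i₀ i₁ (t + 2)).card = 3 := by
  have h : newPairs i₀ i₁ (t + 2) = Finset.univ.filter fun σ : Fin 2 × Fin 2 =>
      σ.1 = σ.2 ∨ σ = (1 - altSeq i₀ i₁ (t + 2), altSeq i₀ i₁ (t + 2)) := by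
    ext σ
    simp [mem_newPairs, mem_attainable, altSeq]
  rw [h]
  generalize altSeq i₀ i₁ (t + 2) = b
  revert b; decide

lemma sum_card_newPairs (i₀ i₁ : Fin 2) (n : ℕ) :
    ∑ r ∈ Finset.range (n + 2), (newPairs i₀ i₁ r).card = 3 * n + 3 := by
  induction n with
  | zero => simp [Finset.sum_range_succ, card_newPairs_zero, card_newPairs_one]
  | succ n ih =>
    rw [Finset.sum_range_succ, ih, card_newPairs_add_two]
    ring

lemma pair_mem_newPairs_of_lt_two {i₀ i₁ : Fin 2} {y : ℕ → Fin 2} (h0 : y 0 = i₀) (h1 : y 1 = i₁)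
    {t : ℕ} (ht : t < 2) : (y (t + 1), y t) ∈ newPairs i₀ i₁ t := by
  refine mem_newPairs.2 ⟨pair_mem_attainable h0 h1 t, ?_⟩
  interval_cases t
  · simp [h0, h1, altSeq]
  · simp only [h1, altSeq, Prod.mk.injEq, and_true, Nat.reduceAdd]
    have : ∀ b d : Fin 2, b = d ∨ b = 1 - d := by decide
    exact this _ _

/-- A non-constant pair occurs along a sequence at most as often as it is a new pair. -/
lemma sum_ite_pair_le {i₀ i₁ : Fin 2} {y : ℕ → Fin 2} (h0 : y 0 = i₀) (h1 : y 1 = i₁)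
    {σ : Fin 2 × Fin 2} (hσ : σ.1 ≠ σ.2) : ∀ t,
    ∑ r ∈ Finset.range t, (if σ = (y (r + 1), y r) then 1 else 0) ≤
      ∑ r ∈ Finset.range t, (if σ ∈ newPairs i₀ i₁ r then 1 else 0)
  | 0 => by simp
  | 1 => by
    refine Finset.sum_le_sum fun r hr => ?_
    split_ifs with h h'
    · rfl
    · exact absurd (h ▸ pair_mem_newPairs_of_lt_two h0 h1 (by simp at hr; omega)) h'
    · simp
    · rfl
  | 2 => by
    refine Finset.sum_le_sum fun r hr => ?_
    split_ifs with h h'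
    · rfl
    · exact absurd (h ▸ pair_mem_newPairs_of_lt_two h0 h1 (by simpa using hr)) h'
    · simp
    · rfl
  | t + 3 => by
    -- Induction in steps of two: a non-constant pair occurs at most once in two consecutive periods
    -- of a path, and exactly one of the two alternating pairs equals it.
    have ih := sum_ite_pair_le h0 h1 hσ (t + 1)
    simp only [Finset.sum_range_succ _ (t + 2), Finset.sum_range_succ _ (t + 1), add_assoc]
    refine add_le_add ih (le_trans (b := 1) ?_ ?_)
    · split_ifs with h h'
      · refine absurd ?_ hσ
        rw [h] at h'
        rw [h]
        exact (Prod.ext_iff.1 h').2.symm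
      · rfl
      · rfl
      · simp
    · have h : σ ∈ newPairs i₀ i₁ (t + 1) ∨ σ ∈ newPairs i₀ i₁ (t + 2) := by
        have h2 := altSeq_mem_newPairs i₀ i₁ (t + 1)
        have h3 := altSeq_mem_newPairs i₀ i₁ (t + 2)
        simp only [altSeq] at h2 h3
        generalize altSeq i₀ i₁ (t + 1) = b at h2 h3
        have : ∀ (b : Fin 2) (σ : Fin 2 × Fin 2), σ.1 ≠ σ.2 →
            σ = (1 - b, b) ∨ σ = (1 - (1 - b), 1 - b) := by decide
        rcases this b σ hσ with h | h
        · exact Or.inl (h ▸ h2)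
        · exact Or.inr (h ▸ h3)
      rcases h with h | h <;> simp [h]

lemma sum_pair_le_sum_newPairs {i₀ i₁ : Fin 2} {y : ℕ → Fin 2} (h0 : y 0 = i₀) (h1 : y 1 = i₁)
    (t : ℕ) : ∑ r ∈ Finset.range t, ({(y (r + 1), y r)} : Multiset (Fin 2 × Fin 2)) ≤
      ∑ r ∈ Finset.range t, (newPairs i₀ i₁ r).val := by
  refine Multiset.le_iff_count.2 fun σ => ?_
  rw [Multiset.count_sum', Multiset.count_sum']
  simp only [Multiset.count_singleton, Multiset.count_eq_of_nodup (Finset.nodup _),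
    Finset.mem_val]
  by_cases hσ : σ.1 = σ.2
  · refine Finset.sum_le_sum fun r _ => ?_
    split_ifs with h h'
    · rfl
    · exact absurd (mem_newPairs.2 ⟨h ▸ pair_mem_attainable h0 h1 r, Or.inl hσ⟩) h'
    · simp
    · rfl
  · exact sum_ite_pair_le h0 h1 hσ t

/-- The values of the odds factor in period `t` at the new pairs. -/
def newFactors (v : Fin 2 → Fin 2 → ℝ) (i₀ i₁ : Fin 2) (t : ℕ) : Multiset ℝ :=
  (newPairs i₀ i₁ t).val.map fun σ => v σ.1 σ.2

lemma card_sum_newFactors (v : Fin 2 → Fin 2 → ℝ) (i₀ i₁ : Fin 2) (n : ℕ) :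
    (∑ r ∈ Finset.range (n + 2), newFactors v i₀ i₁ r).card = 3 * n + 3 := by
  rw [Multiset.card_sum, ← sum_card_newPairs i₀ i₁ n]
  exact Finset.sum_congr rfl fun r _ => by rw [newFactors, Multiset.card_map]; rfl

lemma pos_of_mem_sum_newFactors {v : Fin 2 → Fin 2 → ℝ} (hv : ∀ i j, 0 < v i j)
    {i₀ i₁ : Fin 2} {n : ℕ} : ∀ d ∈ ∑ r ∈ Finset.range n, newFactors v i₀ i₁ r, 0 < d := by
  intro d hd
  obtain ⟨r, -, hr⟩ := Multiset.mem_sum.1 hd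
  obtain ⟨σ, -, rfl⟩ := Multiset.mem_map.1 hr
  exact hv _ _

/-- If the factors do not depend on the period and those of the constant pairs differ from all
others, then the outcome probabilities span the fractions given by the new factors. -/
lemma pathSpan_eq_fracSpace_newFactors {v : Fin 2 → Fin 2 → ℝ} (hv : ∀ i j, 0 < v i j)
    (i₀ i₁ : Fin 2) (n : ℕ)
    (hvc : ∀ (b : Fin 2) (σ : Fin 2 × Fin 2), v σ.1 σ.2 = v b b → σ = (b, b)) :
    pathSpan (fun _ => v) i₀ i₁ n =
      fracSpace (∑ r ∈ Finset.range n, newFactors v i₀ i₁ r) := by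
  classical
  set J : ℕ → Finset ℝ := fun t => (newPairs i₀ i₁ t).image fun σ => v σ.1 σ.2 with hJ
  have hJval : ∀ t, (J t).val = newFactors v i₀ i₁ t := by
    -- A period has at most one non-constant new pair, so v 0 1 = v 1 0 does no harm.
    refine fun t => Finset.image_val_of_injOn fun σ hσ τ hτ h => ?_
    rcases (mem_newPairs.1 hσ).2 with h1 | h1
    · refine (?_ : τ = σ).symm
      rw [hvc σ.1 τ (h.symm.trans (by simp [← h1]))]
      exact Prod.ext rfl h1
    rcases (mem_newPairs.1 hτ).2 with h2 | h2
    · rw [hvc τ.1 σ (h.trans (by simp [← h2]))]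
      exact Prod.ext rfl h2
    rw [h1, h2]
  simp only [← hJval]
  refine pathSpan_eq_fracSpace (fun _ => hv) n (fun t _ y h0 h1 => ?_) fun t _ d hd => ?_
  · have := Multiset.map_le_map (f := fun σ : Fin 2 × Fin 2 => v σ.1 σ.2)
      (sum_pair_le_sum_newPairs h0 h1 t)
    rw [← Multiset.coe_mapAddMonoidHom, map_sum, map_sum] at this
    rw [pathFactors_eq_sum]
    simpa only [hJval, newFactors, pathFactor, Multiset.coe_mapAddMonoidHom,
      Multiset.map_singleton] using this
  obtain ⟨σ, hσ, rfl⟩ := Finset.mem_image.1 hd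
  have hJr : ∀ r, v σ.1 σ.2 ∈ J r → ∃ τ ∈ newPairs i₀ i₁ r, v τ.1 τ.2 = v σ.1 σ.2 := fun r hr =>
    Finset.mem_image.1 hr
  -- The path constant after the initial values serves a constant pair, the alternating path a
  -- non-constant one.
  by_cases hσc : σ.1 = σ.2
  · obtain ⟨b, b'⟩ := σ
    obtain rfl : b = b' := hσc
    let y : ℕ → Fin 2 := fun k => if k = 0 then i₀ else if k = 1 then i₁ else b
    have hy : ∀ r, (b, b) ∈ newPairs i₀ i₁ r → pathFactor (fun _ => v) y r = v b b := by
      intro r hr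
      have ha := mem_attainable.1 (mem_newPairs.1 hr).1
      have h : y (r + 1) = b ∧ y r = b := by
        rcases r with _ | _ | r
        · have hb := Prod.ext_iff.1 (ha.1 rfl)
          exact ⟨hb.1.symm, hb.2.symm⟩
        · exact ⟨rfl, (ha.2 rfl).symm⟩
        · exact ⟨rfl, rfl⟩
      rw [pathFactor, h.1, h.2]
    refine ⟨y, rfl, rfl, hy t hσ, fun r _ hr => ?_⟩
    obtain ⟨τ, hτ, h⟩ := hJr r hr
    exact hy r (hvc b τ h ▸ hτ)
  · refine ⟨altSeq i₀ i₁, rfl, rfl, ?_, fun r _ hr => ?_⟩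
    · rw [pathFactor, (mem_newPairs.1 hσ).2.resolve_left hσc]
    · obtain ⟨τ, hτ, h⟩ := hJr r hr
      rcases (mem_newPairs.1 hτ).2 with h1 | h1
      · refine absurd ?_ hσc
        rw [hvc τ.1 σ (h.symm.trans (by simp [← h1]))]
      · rw [← h, pathFactor, h1]

/-! ### Translation of the AR(2) model. -/

/-- The sequence `y_{-1}, y_0, y_1, …, y_T, 0, 0, …`. -/
def outcomeSeq {T : ℕ} (ym1 y0 : Fin 2) (y : Outcome T) : ℕ → Fin 2
  | 0 => ym1
  | 1 => y0
  | t + 2 => if h : t < T then y ⟨t, h⟩ else 0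

lemma outcomeSeq_add_two {T : ℕ} (ym1 y0 : Fin 2) (y : Outcome T) (t : Fin T) :
    outcomeSeq ym1 y0 y (t + 2) = y t := by
  simp [outcomeSeq]

lemma lagOne_eq {T : ℕ} (ym1 y0 : Fin 2) (y : Outcome T) (t : Fin T) :
    lagOne y0 y t = outcomeSeq ym1 y0 y (t + 1) := by
  obtain ⟨t, ht⟩ := t
  rcases t with _ | t
  · rfl
  · exact (outcomeSeq_add_two ym1 y0 y ⟨t, by omega⟩).symm

lemma lagTwo_eq {T : ℕ} (ym1 y0 : Fin 2) (y : Outcome T) (t : Fin T) :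
    lagTwo ym1 y0 y t = outcomeSeq ym1 y0 y t := by
  obtain ⟨t, ht⟩ := t
  rcases t with _ | _ | t
  · rfl
  · rfl
  · exact (outcomeSeq_add_two ym1 y0 y ⟨t, by omega⟩).symm

/-- The index `x_t' β`, set to zero after the last period. -/
noncomputable def covIndex {T K : ℕ} (x : Fin T → Fin K → ℝ) (β : Fin K → ℝ) (t : ℕ) : ℝ :=
  if h : t < T then x ⟨t, h⟩ ⬝ᵥ β else 0

/-- The odds factor in period `t` after the outcomes `i` (last) and `j` (before). -/
noncomputable def oddsFactor (u : ℕ → ℝ) (γ₁ γ₂ : ℝ) (t : ℕ) (i j : Fin 2) : ℝ :=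
  Real.exp (u t + ((i : ℕ) : ℝ) * γ₁ + ((j : ℕ) : ℝ) * γ₂)

lemma oddsFactor_pos (u : ℕ → ℝ) (γ₁ γ₂ : ℝ) (t : ℕ) (i j : Fin 2) :
    0 < oddsFactor u γ₁ γ₂ t i j := Real.exp_pos _

lemma oddsFactor_eq_iff {u : ℕ → ℝ} {γ₁ γ₂ : ℝ} {t t' : ℕ} {i j i' j' : Fin 2} :
    oddsFactor u γ₁ γ₂ t i j = oddsFactor u γ₁ γ₂ t' i' j' ↔
      u t + ((i : ℕ) : ℝ) * γ₁ + ((j : ℕ) : ℝ) * γ₂ =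
        u t' + ((i' : ℕ) : ℝ) * γ₁ + ((j' : ℕ) : ℝ) * γ₂ :=
  Real.exp_eq_exp

lemma logit_eq (b : Fin 2) (w a : ℝ) :
    1 / (1 + Real.exp ((1 - 2 * ((b : ℕ) : ℝ)) * (w + a))) =
      (if b = 1 then Real.exp w * Real.exp a else 1) / (1 + Real.exp w * Real.exp a) := by
  rw [← Real.exp_add]
  have := Real.exp_pos (w + a)
  fin_cases b
  · simp
  · have h : (1 - 2 * ((((1 : Fin 2) : ℕ) : ℝ))) * (w + a) = -(w + a) := by
      simp
      ring
    change 1 / (1 + Real.exp ((1 - 2 * ((((1 : Fin 2) : ℕ) : ℝ))) * (w + a))) = _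
    rw [h, Real.exp_neg]
    simp
    field_simp
    ring

section

variable {T K : ℕ} (ym1 y0 : Fin 2) (x : Fin T → Fin K → ℝ) (β : Fin K → ℝ) (γ₁ γ₂ : ℝ)

lemma ar2Prob_eq_pathProb (y : Outcome T) : (fun a => ar2Prob ym1 y0 x β γ₁ γ₂ a y) =
    pathProb (oddsFactor (covIndex x β) γ₁ γ₂) T (outcomeSeq ym1 y0 y) := by
  ext a
  rw [ar2Prob, pathProb, Finset.prod_range]
  refine Finset.prod_congr rfl fun t _ => ?_
  rw [logit_eq, lagOne_eq ym1, lagTwo_eq, outcomeSeq_add_two]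
  simp [pathFactor, oddsFactor, covIndex]

lemma span_ar2Prob_eq_pathSpan :
    Submodule.span ℝ (Set.range fun y : Outcome T => fun a => ar2Prob ym1 y0 x β γ₁ γ₂ a y) =
      pathSpan (oddsFactor (covIndex x β) γ₁ γ₂) ym1 y0 T := by
  rw [pathSpan]
  congr 1
  ext f
  constructor
  · rintro ⟨y, rfl⟩
    exact ⟨outcomeSeq ym1 y0 y, ⟨rfl, rfl⟩, (ar2Prob_eq_pathProb ym1 y0 x β γ₁ γ₂ y).symm⟩
  · rintro ⟨y, ⟨h0, h1⟩, rfl⟩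
    refine ⟨fun t => y (t + 2), ?_⟩
    -- The probability of T periods reads only the terms below T + 2, so the zeros appended by
    -- `outcomeSeq` are immaterial.
    have h : ∀ t < T + 2, outcomeSeq ym1 y0 (fun t : Fin T => y (t + 2)) t = y t := by
      intro t ht
      rcases t with _ | _ | t
      · exact h0.symm
      · exact h1.symm
      · exact outcomeSeq_add_two ym1 y0 _ ⟨t, by omega⟩
    simp only
    rw [ar2Prob_eq_pathProb]
    ext a
    refine Finset.prod_congr rfl fun t ht => ?_
    have ht' := Finset.mem_range.1 ht
    rw [pathFactor, pathFactor, h _ (by omega), h _ (by omega), h _ (by omega)]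

/-! ### Dimension and rank counts. -/

lemma finrank_ar2MomentSpace_add :
    Module.finrank ℝ (ar2MomentSpace ym1 y0 x β γ₁ γ₂) + Module.finrank ℝ
      (pathSpan (oddsFactor (covIndex x β) γ₁ γ₂) ym1 y0 T) = 2 ^ T := by
  set f := Fintype.linearCombination ℝ
    (fun y : Outcome T => fun a => ar2Prob ym1 y0 x β γ₁ γ₂ a y) with hf
  have hker : ar2MomentSpace ym1 y0 x β γ₁ γ₂ = LinearMap.ker f := by
    ext m
    rw [LinearMap.mem_ker, funext_iff]
    refine forall_congr' fun a => ?_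
    simp [hf, Fintype.linearCombination_apply, mul_comm]
  have hrange : pathSpan (oddsFactor (covIndex x β) γ₁ γ₂) ym1 y0 T = LinearMap.range f := by
    rw [hf, Fintype.range_linearCombination, span_ar2Prob_eq_pathSpan]
  rw [hker, hrange, add_comm, LinearMap.finrank_range_add_finrank_ker]
  simp

lemma le_finrank_ar2MomentSpace (hT : 2 ≤ T) :
    2 ^ T - 4 * (T - 1) ≤ Module.finrank ℝ (ar2MomentSpace ym1 y0 x β γ₁ γ₂) := by
  obtain ⟨n, rfl⟩ := Nat.exists_eq_add_of_le' hT
  have hc := oddsFactor_pos (covIndex x β) γ₁ γ₂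
  have h := pathSpan_le_fracSpace_attainable hc ym1 y0 (n + 2)
  have hr := finrank_fracSpace (pos_of_mem_sum_attainableFactors hc (i₀ := ym1) (i₁ := y0)
    (n := n + 2))
  rw [card_sum_attainableFactors] at hr
  -- Monotonicity of `finrank` needs a finite-dimensional target.
  have := Module.finite_of_finrank_pos (hr.trans_gt (Nat.succ_pos (4 * n + 3)))
  have hle := Submodule.finrank_mono h
  have := finrank_ar2MomentSpace_add ym1 y0 x β γ₁ γ₂
  omega

lemma finrank_ar2MomentSpace_of_general (hT : 2 ≤ T) (h1 : γ₁ ≠ 0) (h2 : γ₂ ≠ 0)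
    (h12 : γ₁ + γ₂ ≠ 0) (hne : γ₁ ≠ γ₂) (hx : GeneralCovariates x β γ₁ γ₂) :
    Module.finrank ℝ (ar2MomentSpace ym1 y0 x β γ₁ γ₂) = 2 ^ T - 4 * (T - 1) := by
  have hc := oddsFactor_pos (covIndex x β) γ₁ γ₂
  have h : pathSpan (oddsFactor (covIndex x β) γ₁ γ₂) ym1 y0 T = fracSpace
      (∑ r ∈ Finset.range T, attainableFactors (oddsFactor (covIndex x β) γ₁ γ₂) ym1 y0 r) := by
    refine pathSpan_eq_fracSpace_attainable hc ym1 y0 T (fun t _ => ?_) fun t ht1 htT => ?_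
    · rintro ⟨p, q⟩ ⟨p', q'⟩ h
      have h' := oddsFactor_eq_iff.1 h
      fin_cases p <;> fin_cases q <;> fin_cases p' <;> fin_cases q' <;> simp at h' ⊢ <;>
        first
        | exact h1 (by linarith)
        | exact h2 (by linarith)
        | exact h12 (by linarith)
        | exact hne (by linarith)
    · rintro ⟨p, q⟩ ⟨p', q'⟩ h
      have h' := oddsFactor_eq_iff.1 h
      have hg := hx ⟨t, by omega⟩ ⟨t + 1, htT⟩ ht1 rfl
      rw [covIndex, covIndex, dif_pos (show t < T by omega), dif_pos htT] at h'
      simp only [Set.mem_insert_iff, Set.mem_singleton_iff, not_or] at hg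
      obtain ⟨g0, g1, g2, g3, g4, g5, g6⟩ := hg
      generalize x ⟨t, _⟩ ⬝ᵥ β = u at *
      generalize x ⟨t + 1, _⟩ ⬝ᵥ β = w at *
      -- For incompatible pairs, q' ≠ p, equal factors force w - u to be one of the seven excluded
      -- values. The differences ±(γ₁ - γ₂) arise only from compatible pairs.
      fin_cases p <;> fin_cases q <;> fin_cases p' <;> fin_cases q' <;> simp at h' ⊢ <;>
        first
        | exact g0 (by linarith)
        | exact g1 (by linarith)
        | exact g2 (by linarith)
        | exact g3 (by linarith)
        | exact g4 (by linarith)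
        | exact g5 (by linarith)
        | exact g6 (by linarith)
  obtain ⟨n, rfl⟩ := Nat.exists_eq_add_of_le' hT
  have hr := finrank_fracSpace (pos_of_mem_sum_attainableFactors hc (i₀ := ym1) (i₁ := y0)
    (n := n + 2))
  rw [card_sum_attainableFactors, ← h] at hr
  have := finrank_ar2MomentSpace_add ym1 y0 x β γ₁ γ₂
  omega

/-- The constant pairs have log factors 0 and γ₁ + γ₂; these must differ from each other and from γ₁
and γ₂, while γ₁ = γ₂ is allowed. -/
lemma pathSpan_of_beta_zero (h1 : γ₁ ≠ 0) (h2 : γ₂ ≠ 0) (h12 : γ₁ + γ₂ ≠ 0) :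
    pathSpan (oddsFactor (covIndex x 0) γ₁ γ₂) ym1 y0 T = fracSpace
      (∑ r ∈ Finset.range T, newFactors (oddsFactor (fun _ => 0) γ₁ γ₂ 0) ym1 y0 r) := by
  have hu : covIndex x 0 = fun _ => 0 := by
    ext t
    simp [covIndex]
  rw [hu]
  refine pathSpan_eq_fracSpace_newFactors (v := oddsFactor (fun _ => 0) γ₁ γ₂ 0)
    (oddsFactor_pos _ γ₁ γ₂ 0) ym1 y0 T ?_
  rintro b ⟨p, q⟩ h
  have h' := oddsFactor_eq_iff.1 h
  fin_cases b <;> fin_cases p <;> fin_cases q <;> simp at h' ⊢ <;>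
    first
    | exact h1 (by linarith)
    | exact h2 (by linarith)
    | exact h12 (by linarith)

lemma finrank_ar2MomentSpace_of_beta_zero (hT : 2 ≤ T) (h1 : γ₁ ≠ 0) (h2 : γ₂ ≠ 0)
    (h12 : γ₁ + γ₂ ≠ 0) :
    Module.finrank ℝ (ar2MomentSpace ym1 y0 x 0 γ₁ γ₂) = 2 ^ T - (3 * T - 2) := by
  have h := pathSpan_of_beta_zero ym1 y0 x γ₁ γ₂ h1 h2 h12
  obtain ⟨n, rfl⟩ := Nat.exists_eq_add_of_le' hT
  have hr := finrank_fracSpace (pos_of_mem_sum_newFactors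
    (oddsFactor_pos (fun _ => 0) γ₁ γ₂ 0) (i₀ := ym1) (i₁ := y0) (n := n + 2))
  rw [card_sum_newFactors, ← h] at hr
  have := finrank_ar2MomentSpace_add ym1 y0 x 0 γ₁ γ₂
  omega

lemma rank_ar2ProbMatrix_of_beta_zero (hT : 2 ≤ T) (h1 : γ₁ ≠ 0) (h2 : γ₂ ≠ 0)
    (h12 : γ₁ + γ₂ ≠ 0) {α : Fin (2 ^ T) → ℝ} (hα : Function.Injective α) :
    (ar2ProbMatrix ym1 y0 x 0 γ₁ γ₂ α).rank = 3 * T - 2 := by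
  have h := pathSpan_of_beta_zero ym1 y0 x γ₁ γ₂ h1 h2 h12
  set s := ∑ r ∈ Finset.range T, newFactors (oddsFactor (fun _ => 0) γ₁ γ₂ 0) ym1 y0 r with hs
  have hpos : ∀ d ∈ s, 0 < d := pos_of_mem_sum_newFactors (oddsFactor_pos (fun _ => 0) γ₁ γ₂ 0)
  have hcard : s.card + 1 = 3 * T - 2 := by
    obtain ⟨n, rfl⟩ := Nat.exists_eq_add_of_le' hT
    rw [hs, card_sum_newFactors]
    omega
  have hlt : s.card < 2 ^ T := by
    have h3 : ∀ n, 3 * n + 3 < 2 ^ (n + 2) := by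
      intro n
      induction n with
      | zero => norm_num
      | succ n ih => rw [pow_succ]; omega
    obtain ⟨n, rfl⟩ := Nat.exists_eq_add_of_le' hT
    have := h3 n
    omega
  set e : (ℝ → ℝ) →ₗ[ℝ] (Fin (2 ^ T) → ℝ) := LinearMap.funLeft ℝ ℝ α with he
  have hcols : Set.range (ar2ProbMatrix ym1 y0 x 0 γ₁ γ₂ α).col =
      e '' Set.range fun y : Outcome T => fun a => ar2Prob ym1 y0 x 0 γ₁ γ₂ a y := by
    rw [← Set.range_comp, ← finFunctionFinEquiv.symm.surjective.range_comp]
    rfl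
  -- A numerator of degree at most |s| < 2^T is determined by its values at the 2^T distinct points
  -- exp (α g), so sampling loses no rank.
  have hinj : Function.Injective (e.domRestrict (fracSpace s)) := by
    rw [← LinearMap.ker_eq_bot, LinearMap.ker_eq_bot']
    rintro ⟨_, P, hP, rfl⟩ h0
    have : P = 0 := eq_zero_of_mem_fracSpace hpos hP hα (by simpa using hlt)
      fun i => congrFun h0 i
    exact Subtype.ext ((congrArg (fracMap s) this).trans (map_zero _))
  rw [Matrix.rank_eq_finrank_span_cols, hcols, Submodule.span_image, span_ar2Prob_eq_pathSpan, h,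
    ← LinearMap.range_domRestrict, LinearMap.finrank_range_of_inj hinj, finrank_fracSpace hpos,
    hcard]

lemma ae_generalCovariates {β : Fin K → ℝ} (hβ : β ≠ 0) :
    ∀ᵐ x : Fin T → Fin K → ℝ ∂volume, GeneralCovariates x β γ₁ γ₂ := by
  simp only [GeneralCovariates, ae_all_iff]
  intro s t _ hst
  have hne : t ≠ s := fun h => by
    rw [h] at hst
    omega
  let f : (Fin T → Fin K → ℝ) →ₗ[ℝ] ℝ :=
    { toFun := fun x => x t ⬝ᵥ β - x s ⬝ᵥ β
      map_add' := fun x y => by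
        simp only [Pi.add_apply, add_dotProduct]
        ring
      map_smul' := fun r x => by
        simp only [Pi.smul_apply, smul_dotProduct, RingHom.id_apply, smul_sub] }
  have hf : Function.Surjective f := by
    refine LinearMap.surjective fun h0 => ?_
    -- Moving only x_t, in the direction β, changes the functional by β · β.
    have h := LinearMap.congr_fun h0 (Pi.single t β)
    have h' : β ⬝ᵥ β = 0 := by
      simpa [f, Pi.single_eq_of_ne hne.symm] using h
    exact hβ (dotProduct_self_eq_zero.1 h')
  refine (ae_comp_linearMap_mem_iff f volume volume hf
    (s := ({0, γ₁, -γ₁, γ₂, -γ₂, γ₁ + γ₂, -(γ₁ + γ₂)} : Set ℝ)ᶜ) ?_).2 ?_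
  · exact (Set.toFinite _).measurableSet.compl
  · exact (Set.toFinite _).measure_zero _ |> compl_mem_ae_iff.2

end

/-- No regularity in x is asked of a family, so independent elements can be chosen separately for
each x; a single x of minimal dimension gives the upper bound. -/
lemma isGreatest_card_moment_families {T K : ℕ} (ym1 y0 : Fin 2) (β : Fin K → ℝ) (γ₁ γ₂ : ℝ) {N : ℕ}
    (hle : ∀ x : Fin T → Fin K → ℝ,
      N ≤ Module.finrank ℝ (ar2MomentSpace ym1 y0 x β γ₁ γ₂))
    (hex : ∃ x : Fin T → Fin K → ℝ,
      Module.finrank ℝ (ar2MomentSpace ym1 y0 x β γ₁ γ₂) = N) :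
    IsGreatest {N : ℕ | ∃ m : Fin N → (Fin T → Fin K → ℝ) → Outcome T → ℝ,
      ∀ x : Fin T → Fin K → ℝ, (∀ i, m i x ∈ ar2MomentSpace ym1 y0 x β γ₁ γ₂) ∧
        LinearIndependent ℝ (fun i => m i x)} N := by
  constructor
  · choose f hf using fun x => exists_linearIndependent_of_le_finrank (hle x)
    exact ⟨fun i x => f x i, fun x => ⟨fun i => (f x i).2,
      (hf x).map' (Submodule.subtype _) (Submodule.ker_subtype _)⟩⟩
  · rintro M ⟨m, hm⟩
    obtain ⟨x, rfl⟩ := hex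
    have hli : LinearIndependent ℝ
        (fun i => (⟨m i x, (hm x).1 i⟩ : ar2MomentSpace ym1 y0 x β γ₁ γ₂)) :=
      LinearIndependent.of_comp (Submodule.subtype _) (hm x).2
    simpa using hli.fintype_card_le_finrank

theorem mainTheorem3 (T : ℕ) (hT : T = 3 ∨ T = 4 ∨ T = 5) (K : ℕ) (ym1 y0 : Fin 2)
    (γ₁ γ₂ : ℝ) :
    -- the model without covariates, `β = 0`
    (γ₁ ≠ 0 → γ₂ ≠ 0 → γ₁ + γ₂ ≠ 0 → ∀ x : Fin T → Fin K → ℝ,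
      (∀ α : Fin (2 ^ T) → ℝ, StrictMono α →
        (ar2ProbMatrix ym1 y0 x 0 γ₁ γ₂ α).rank = 3 * T - 2) ∧
      Module.finrank ℝ (ar2MomentSpace ym1 y0 x 0 γ₁ γ₂) = 2 ^ T - (3 * T - 2)) ∧
    -- the model with covariates: never fewer moment functions than claimed
    (∀ (x : Fin T → Fin K → ℝ) (β : Fin K → ℝ),
      2 ^ T - 4 * (T - 1) ≤ Module.finrank ℝ (ar2MomentSpace ym1 y0 x β γ₁ γ₂)) ∧
    -- the model with covariates: exactly as many as claimed
    (γ₁ ≠ 0 → γ₂ ≠ 0 → γ₁ + γ₂ ≠ 0 → γ₁ ≠ γ₂ → ∀ β : Fin K → ℝ,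
      (∀ x : Fin T → Fin K → ℝ, GeneralCovariates x β γ₁ γ₂ →
        Module.finrank ℝ (ar2MomentSpace ym1 y0 x β γ₁ γ₂) = 2 ^ T - 4 * (T - 1)) ∧
      (β ≠ 0 →
        (∀ᵐ x : Fin T → Fin K → ℝ ∂volume,
          Module.finrank ℝ (ar2MomentSpace ym1 y0 x β γ₁ γ₂) = 2 ^ T - 4 * (T - 1)) ∧
        -- families of moment functions that are valid for all covariates
        IsGreatest {N : ℕ | ∃ m : Fin N → (Fin T → Fin K → ℝ) → Outcome T → ℝ,
            ∀ x : Fin T → Fin K → ℝ,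
              (∀ i, m i x ∈ ar2MomentSpace ym1 y0 x β γ₁ γ₂) ∧
              LinearIndependent ℝ (fun i => m i x)}
          (2 ^ T - 4 * (T - 1)))) := by
  have hT2 : 2 ≤ T := by omega
  refine ⟨fun h1 h2 h12 x => ⟨fun α hα => ?_, ?_⟩, fun x β => ?_,
    fun h1 h2 h12 hne β => ⟨fun x hx => ?_, fun hβ => ?_⟩⟩
  · exact rank_ar2ProbMatrix_of_beta_zero ym1 y0 x γ₁ γ₂ hT2 h1 h2 h12 hα.injective
  · exact finrank_ar2MomentSpace_of_beta_zero ym1 y0 x γ₁ γ₂ hT2 h1 h2 h12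
  · exact le_finrank_ar2MomentSpace ym1 y0 x β γ₁ γ₂ hT2
  · exact finrank_ar2MomentSpace_of_general ym1 y0 x β γ₁ γ₂ hT2 h1 h2 h12 hne hx
  · have hae : ∀ᵐ x : Fin T → Fin K → ℝ ∂volume,
        Module.finrank ℝ (ar2MomentSpace ym1 y0 x β γ₁ γ₂) = 2 ^ T - 4 * (T - 1) :=
      (ae_generalCovariates γ₁ γ₂ hβ).mono fun x hx =>
        finrank_ar2MomentSpace_of_general ym1 y0 x β γ₁ γ₂ hT2 h1 h2 h12 hne hx
    exact ⟨hae, isGreatest_card_moment_families ym1 y0 β γ₁ γ₂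
      (fun x => le_finrank_ar2MomentSpace ym1 y0 x β γ₁ γ₂ hT2) hae.exists⟩
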